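/- Let $d\ge 1$ and let $(\xi_n)_{n\ge 1}$ be independent and identically distributed random vectors of $\mathbb R^d$, defined on a probability space $(\Omega,\mathcal F,\mathbb P)$, square integrable, with $\mathbb E(\xi_1)=0$ and $\mathrm{Cov}(\xi_1)=\sigma^2 I_d$ for some $\sigma>0$. Put $S_n=\xi_1+\cdots+\xi_n$ and, for $n\ge1$ and $t\in[0,1]$, $$\mathcal S_n(t)=\frac{S_{[nt]}}{\sigma\sqrt n}+(nt-[nt])\frac{\xi_{[nt]+1}}{\sigma\sqrt n},$$ where $[a]$ is the integer part of $a$. Let $C\subset\mathbb R^d$ be a (Borel) set that is a convex cone (that is, $C$ is convex and $\lambda C=C$ for every $\lambda>0$) with non-empty interior and such that $\mathbb P(\xi_1\in C\setminus\{0\})>0$. Let $T_C=\inf\{n\ge1: S_n\notin C\}$ (with $\inf\emptyset=\infty$). Let $\mathcal C_1$ be the space of continuous functions $w:[0,1]\to\mathbb R^d$ with the topology of uniform convergence and its Borel $\sigma$-algebra, and let $Q_n$ be the distribution on $\mathcal C_1$ of $\mathcal S_n$ conditional on $\{T_C>n\}$, i.e. $Q_n(B)=\mathbb P(\mathcal S_n\in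 B\mid T_C>n)$ for every Borel set $B\subset\mathcal C_1$. Let $Q$ be a probability measure on $\mathcal C_1$ that is the weak limit of some subsequence of $(Q_n)$. Suppose that the non-increasing sequence of positive numbers $u_n=\mathbb P(T_C>n)$ is dominatedly varying, i.e. $\limsup_{n\to\infty}u_{[nt]}/u_n<\infty$ for every $t\in(0,1]$. Then the boundary $\partial C$ is unreachable for $Q$, i.e. $$Q\bigl(w(t)\in\partial C\bigr)=0\qquad\text{for all } t\in(0,1].$$ -/

import Mathlib

open MeasureTheory ProbabilityTheory Filter Topology
open scoped Pointwise ENNReal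

namespace ConeWalk

/-- The state space `ℝ^d` with its Euclidean norm. -/
abbrev Space (d : ℕ) : Type := EuclideanSpace ℝ (Fin d)

/-- The space of continuous paths `w : [0,1] → ℝ^d`.  Its Mathlib topology (compact-open) is the
topology of uniform convergence. -/
abbrev PathSpace (d : ℕ) : Type := C(unitInterval, Space d)

/-- The path space carries the Borel σ-algebra of the uniform topology. -/
instance instMeasurableSpacePath (d : ℕ) : MeasurableSpace (PathSpace d) := borel _

instance instBorelSpacePath (d : ℕ) : BorelSpace (PathSpace d) := ⟨rfl⟩

section Walk

variable {Ω : Type*} {d : ℕ}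

/-- The random walk `S_n = ξ_1 + ⋯ + ξ_n`.  The increments are indexed from `0`: the function
`ξ i` is the step number `i + 1`. -/
def walk (ξ : ℕ → Ω → Space d) (n : ℕ) (ω : Ω) : Space d :=
  ∑ i ∈ Finset.range n, ξ i ω

/-- The exit time `T_C = inf {n ≥ 1 : S_n ∉ C}`, equal to `⊤` if the walk never leaves `C`. -/
noncomputable def exitTime (ξ : ℕ → Ω → Space d) (C : Set (Space d)) (ω : Ω) : ℕ∞ :=
  sInf {m : ℕ∞ | ∃ k : ℕ, 1 ≤ k ∧ walk ξ k ω ∉ C ∧ m = (k : ℕ∞)}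

/-- The event `{T_C > n}`. -/
def survival (ξ : ℕ → Ω → Space d) (C : Set (Space d)) (n : ℕ) : Set Ω :=
  {ω | (n : ℕ∞) < exitTime ξ C ω}

/-- The linear interpolation `S_[x] + (x - [x]) ξ_{[x]+1}` of the walk at real time `x ≥ 0`. -/
noncomputable def interp (ξ : ℕ → Ω → Space d) (ω : Ω) (x : ℝ) : Space d :=
  walk ξ ⌊x⌋₊ ω + (x - (⌊x⌋₊ : ℝ)) • ξ ⌊x⌋₊ ω

/-- Up to time `N` the interpolated walk is a finite sum of continuous functions of time. -/
theorem interp_eq_sum (ξ : ℕ → Ω → Space d) (ω : Ω) (N : ℕ) (x : ℝ) (hx : 0 ≤ x)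
    (hN : x ≤ N) :
    interp ξ ω x = ∑ i ∈ Finset.range N, max 0 (min 1 (x - (i : ℝ))) • ξ i ω := by
  have hk : ((⌊x⌋₊ : ℕ) : ℝ) ≤ x := Nat.floor_le hx
  have hk' : x < (⌊x⌋₊ : ℝ) + 1 := Nat.lt_floor_add_one x
  have key : ∀ M : ℕ, ⌊x⌋₊ + 1 ≤ M →
      ∑ i ∈ Finset.range M, max 0 (min 1 (x - (i : ℝ))) • ξ i ω = interp ξ ω x := by
    intro M hM
    induction M, hM using Nat.le_induction with
    | base =>
      rw [Finset.sum_range_succ, interp, walk]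
      congr 1
      · refine Finset.sum_congr rfl fun i hi => ?_
        have hi' : (i : ℝ) + 1 ≤ (⌊x⌋₊ : ℝ) := by exact_mod_cast Finset.mem_range.mp hi
        rw [min_eq_left (by linarith), max_eq_right zero_le_one, one_smul]
      · rw [min_eq_right (by linarith), max_eq_right (by linarith)]
    | succ M hM ih =>
      have hM' : (⌊x⌋₊ : ℝ) + 1 ≤ (M : ℝ) := by exact_mod_cast hM
      rw [Finset.sum_range_succ, ih, max_eq_left, zero_smul, add_zero]
      exact (min_le_right _ _).trans (by linarith)
  have hle : ⌊x⌋₊ ≤ N := by exact_mod_cast hk.trans hN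
  rcases hle.lt_or_eq with h | h
  · exact (key N h).symm
  · rw [← key (N + 1) (by omega), Finset.sum_range_succ, max_eq_left, zero_smul, add_zero]
    exact (min_le_right _ _).trans (by linarith)

/-- The normalized and linearly interpolated walk on `[0,1]`:
`t ↦ S_[nt] / (σ √n) + (nt - [nt]) ξ_{[nt]+1} / (σ √n)`. -/
noncomputable def path (ξ : ℕ → Ω → Space d) (σ : ℝ) (n : ℕ) (ω : Ω) : PathSpace d where
  toFun t := (σ * √(n : ℝ))⁻¹ • interp ξ ω ((n : ℝ) * (t : ℝ))
  continuous_toFun := by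
    have h : (fun t : unitInterval => interp ξ ω ((n : ℝ) * (t : ℝ))) = fun t : unitInterval =>
        ∑ i ∈ Finset.range n, max 0 (min 1 ((n : ℝ) * (t : ℝ) - (i : ℝ))) • ξ i ω := by
      funext t
      exact interp_eq_sum ξ ω n _ (mul_nonneg n.cast_nonneg t.2.1)
        (mul_le_of_le_one_right n.cast_nonneg t.2.2)
    have hc : Continuous fun t : unitInterval => interp ξ ω ((n : ℝ) * (t : ℝ)) := by
      rw [h]
      fun_prop
    exact (continuous_const (y := (σ * √(n : ℝ))⁻¹)).smul hc

variable [MeasurableSpace Ω]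

/-- `Q_n`, the law on path space of the normalized interpolated walk under the conditional
probability given `{T_C > n}`.  (It is bundled as a finite measure in order to use Mathlib's
topology of weak convergence; its mass is `1` for an adapted cone.) -/
noncomputable def condLaw (P : Measure Ω) (ξ : ℕ → Ω → Space d) (σ : ℝ) (C : Set (Space d))
    (n : ℕ) : FiniteMeasure (PathSpace d) :=
  ⟨(P[|survival ξ C n]).map (path ξ σ n), inferInstance⟩

/-- `C` is a cone adapted to a walk with first step `X`: a convex linear cone with non-empty
interior such that `X` belongs to `C \ {0}` with positive probability. -/
structure IsAdaptedCone (P : Measure Ω) (X : Ω → Space d) (C : Set (Space d)) : Prop where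
  smul_eq : ∀ c : ℝ, 0 < c → c • C = C
  convex : Convex ℝ C
  interior_nonempty : (interior C).Nonempty
  pos : 0 < P {ω | X ω ∈ C \ {0}}

end Walk

/-- `Q` is the weak limit of some subsequence of the sequence `Qs`. -/
def IsWeakLimitPoint {d : ℕ} (Qs : ℕ → FiniteMeasure (PathSpace d))
    (Q : ProbabilityMeasure (PathSpace d)) : Prop :=
  ∃ φ : ℕ → ℕ, StrictMono φ ∧ Tendsto (fun k => Qs (φ k)) atTop (𝓝 Q.toFiniteMeasure)

/-- Dominated variation of a non-increasing sequence `u` of positive numbers: for every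
`t ∈ (0,1]`, the upper limit of `u_[nt] / u_n` is finite. -/
def DominatedlyVarying (u : ℕ → ℝ) : Prop :=
  ∀ t : ℝ, 0 < t → t ≤ 1 →
    limsup (fun n : ℕ => ((u ⌊(n : ℝ) * t⌋₊ / u n : ℝ) : EReal)) atTop < ⊤

/-- The boundary of `C` is unreachable for `Q`: `Q(w(t) ∈ ∂C) = 0` for all `t ∈ (0,1]`. -/
def BoundaryUnreachable {d : ℕ} (C : Set (Space d)) (Q : ProbabilityMeasure (PathSpace d)) :
    Prop :=
  ∀ t : unitInterval, 0 < t → (Q : Measure (PathSpace d)) {w | w t ∈ frontier C} = 0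

end ConeWalk

/-! Fix `t > 0` and an earlier time `s = t / 2`. A walk that survives up to `n` survives up to `⌊n *
s⌋₊`, and its increment from there to time `n * t` is independent of that past. By the central limit
theorem the normalized increment is nearly Gaussian with variance `t - s > 0`. Its limit law has a
density, and the frontier of a convex set is Lebesgue-null, so from any starting point the frontier
is hit with limiting probability zero. By compactness, some `ε`-neighbourhood of the frontier is
reached with probability at most `δ`, uniformly over starting points in a ball of radius `R`
(`exists_thickening_increment_uniformly_small`).

Paths of norm below `R` therefore contribute at most `δ * P(T_C > ⌊n * s⌋₊)` to the event of being
near the frontier at time `t` (`measure_survival_inter_path_le`). Conditioning divides this by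
`P(T_C > n)`, and dominated variation bounds the quotient by a constant times `δ` (`condLaw_le`).
Paths of larger norm are negligible because the limit `Q` is a finite measure. -/

namespace ConeWalk

/-! ### Gaussian limits, independence and uniform smallness near null sets -/

/-- The isotropic centered Gaussian law of variance `τ`, given by its density, up to the
normalizing constant. -/
theorem exists_gaussian_absolutelyContinuous (d : ℕ) {τ : ℝ} (hτ : 0 < τ) :
    ∃ ν : ProbabilityMeasure (Space d), (ν : Measure (Space d)) ≪ volume ∧
      ∀ u : Space d, charFun (ν : Measure (Space d)) u =
        Complex.exp (τ * (-(‖u‖ : ℂ) ^ 2 / 2)) := by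
  set b : ℝ := 1 / (2 * τ) with hb
  have hb0 : 0 < b := by positivity
  set Z : ℝ := (Real.pi / b) ^ ((d : ℝ) / 2) with hZ
  have hZ0 : 0 < Z := by positivity
  set f : Space d → NNReal := fun v => Real.toNNReal (Z⁻¹ * Real.exp (-b * ‖v‖ ^ 2)) with hf
  have hfm : Measurable f := by fun_prop
  set ν : Measure (Space d) := volume.withDensity fun v => (f v : ℝ≥0∞) with hν
  have hchar : ∀ u : Space d, charFun ν u = Complex.exp (τ * (-(‖u‖ : ℂ) ^ 2 / 2)) := by
    intro u
    rw [charFun_apply, hν, integral_withDensity_eq_integral_smul hfm]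
    have h1 : ∀ v : Space d, f v • Complex.exp ((inner ℝ v u : ℝ) * Complex.I) =
        (Z : ℂ)⁻¹ * Complex.exp (-(b : ℂ) * (‖v‖ : ℂ) ^ 2 + Complex.I * (inner ℝ u v : ℝ)) := by
      intro v
      rw [NNReal.smul_def, hf, Real.coe_toNNReal _ (by positivity), Complex.real_smul,
        Complex.exp_add, real_inner_comm]
      push_cast
      ring_nf
    simp_rw [h1]
    rw [integral_const_mul, GaussianFourier.integral_cexp_neg_mul_sq_norm_add (by simpa using hb0)]
    have h2 : ((Real.pi : ℂ) / (b : ℂ)) ^ ((Module.finrank ℝ (Space d) : ℂ) / 2) = (Z : ℂ) := by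
      rw [hZ, Complex.ofReal_cpow (by positivity)]
      simp
    rw [h2, inv_mul_cancel_left₀ (by exact_mod_cast hZ0.ne')]
    congr 1
    have : (τ : ℂ) ≠ 0 := by exact_mod_cast hτ.ne'
    rw [hb, Complex.I_sq]
    push_cast
    field_simp
    ring
  have hfin : ∫⁻ v, (f v : ℝ≥0∞) ≠ ⊤ := by
    have hint : Integrable (fun v : Space d => Z⁻¹ * Real.exp (-b * ‖v‖ ^ 2)) := by
      refine Integrable.const_mul ?_ _
      by_contra h
      -- A non-integrable function has integral `0` by convention, whereas the Gaussian integral is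
      -- positive.
      have h3 := GaussianFourier.integral_rexp_neg_mul_sq_norm (V := Space d) hb0
      rw [integral_undef h] at h3
      have : 0 < (Real.pi / b) ^ ((Module.finrank ℝ (Space d) : ℝ) / 2) := by positivity
      exact this.ne h3
    exact hint.lintegral_lt_top.ne
  have : IsFiniteMeasure ν := isFiniteMeasure_withDensity hfin
  -- The total mass is the characteristic function at `0`.
  have hprob : IsProbabilityMeasure ν := by
    have h := hchar 0
    rw [charFun_zero] at h
    refine ⟨?_⟩
    have h' : ν.real Set.univ = 1 := by
      have : ((ν.real Set.univ : ℝ) : ℂ) = 1 := by simpa using h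
      exact_mod_cast this
    rw [← ENNReal.ofReal_toReal (measure_ne_top ν Set.univ)]
    change ENNReal.ofReal (ν.real Set.univ) = 1
    rw [h']; simp
  exact ⟨⟨ν, hprob⟩, withDensity_absolutelyContinuous _ _, hchar⟩

/-- Fubini for the product law of `(U, V)`: for each frozen value `a` of `U` in `A`, the inner
integral over `V` is at most `δ`. This is the form in which the Markov property is used. -/
theorem measure_mem_inter_add_mem_le {Ω α E : Type*} [MeasurableSpace Ω] [MeasurableSpace α]
    [AddCommGroup E] [MeasurableSpace E] [MeasurableAdd₂ E] {P : Measure Ω}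
    [IsProbabilityMeasure P] {U : Ω → α} {V : Ω → E} (hU : Measurable U) (hV : Measurable V)
    (hUV : IndepFun U V P) {f : α → E} (hf : Measurable f) {A : Set α} (hA : MeasurableSet A)
    {G : Set E} (hG : MeasurableSet G) {δ : ℝ≥0∞}
    (h : ∀ a ∈ A, P.map V {y | f a + y ∈ G} ≤ δ) :
    P {ω | U ω ∈ A ∧ f (U ω) + V ω ∈ G} ≤ δ * P {ω | U ω ∈ A} := by
  have hB : MeasurableSet {p : α × E | p.1 ∈ A ∧ f p.1 + p.2 ∈ G} :=
    (measurable_fst hA).inter (((hf.comp measurable_fst).add measurable_snd) hG)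
  have : IsProbabilityMeasure (P.map V) := Measure.isProbabilityMeasure_map hV.aemeasurable
  have hmap := (indepFun_iff_map_prod_eq_prod_map_map hU.aemeasurable hV.aemeasurable).1 hUV
  have h1 : P {ω | U ω ∈ A ∧ f (U ω) + V ω ∈ G} =
      ((P.map U).prod (P.map V)) {p : α × E | p.1 ∈ A ∧ f p.1 + p.2 ∈ G} := by
    rw [← hmap, Measure.map_apply (hU.prodMk hV) hB]
    rfl
  rw [h1, Measure.prod_apply hB]
  calc ∫⁻ a, P.map V (Prod.mk a ⁻¹' {p : α × E | p.1 ∈ A ∧ f p.1 + p.2 ∈ G}) ∂(P.map U)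
      ≤ ∫⁻ a, A.indicator (fun _ => δ) a ∂(P.map U) := by
        refine lintegral_mono fun a => ?_
        by_cases ha : a ∈ A
        · simpa [ha, Set.preimage] using h a ha
        · simp [ha, Set.preimage]
    _ = δ * P {ω | U ω ∈ A} := by
        rw [lintegral_indicator_const hA, Measure.map_apply hU hA]
        rfl

/-- If `μ n → ν` weakly and no translate of `ν` charges the closed set `F`, then small thickenings
of `F` are uniformly negligible for the translates of `μ n` by the points of a compact set. -/
theorem exists_thickening_uniformly_small {d : ℕ} {μ : ℕ → ProbabilityMeasure (Space d)}
    {ν : ProbabilityMeasure (Space d)} (hμ : Tendsto μ atTop (𝓝 ν)) {F : Set (Space d)}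
    (hF : IsClosed F) (hν : ∀ x, (ν : Measure (Space d)) {y | x + y ∈ F} = 0)
    {K : Set (Space d)} (hK : IsCompact K) {δ : ℝ≥0∞} (hδ : 0 < δ) :
    ∃ ε > 0, ∀ᶠ n in atTop, ∀ x ∈ K,
      (μ n : Measure (Space d)) {y | x + y ∈ Metric.thickening ε F} ≤ δ := by
  -- The property passes to subsets and finite unions, so compactness reduces it to a neighbourhood
  -- of each point.
  refine hK.induction_on (p := fun K => ∃ ε > 0, ∀ᶠ n in atTop, ∀ x ∈ K,
      (μ n : Measure (Space d)) {y | x + y ∈ Metric.thickening ε F} ≤ δ) ?_ ?_ ?_ ?_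
  · exact ⟨1, one_pos, by simp⟩
  · rintro s t hst ⟨ε, hε, h⟩
    exact ⟨ε, hε, h.mono fun n hn x hx => hn x (hst hx)⟩
  · rintro s t ⟨ε₁, hε₁, h₁⟩ ⟨ε₂, hε₂, h₂⟩
    refine ⟨min ε₁ ε₂, lt_min hε₁ hε₂, ?_⟩
    filter_upwards [h₁, h₂] with n hn₁ hn₂ x hx
    rcases hx with hx | hx
    · have hsub : {y | x + y ∈ Metric.thickening (min ε₁ ε₂) F} ⊆
          {y | x + y ∈ Metric.thickening ε₁ F} := fun y hy =>
        Metric.thickening_mono (min_le_left _ _) F hy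
      exact (measure_mono hsub).trans (hn₁ x hx)
    · have hsub : {y | x + y ∈ Metric.thickening (min ε₁ ε₂) F} ⊆
          {y | x + y ∈ Metric.thickening ε₂ F} := fun y hy =>
        Metric.thickening_mono (min_le_right _ _) F hy
      exact (measure_mono hsub).trans (hn₂ x hx)
  · intro x _
    have hpre : ∀ {S : Set (Space d)}, MeasurableSet S →
        (ν : Measure (Space d)).map (x + ·) S = (ν : Measure (Space d)) {y | x + y ∈ S} :=
      fun hS => Measure.map_apply (measurable_const_add x) hS
    have : IsProbabilityMeasure ((ν : Measure (Space d)).map (x + ·)) :=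
      Measure.isProbabilityMeasure_map (measurable_const_add x).aemeasurable
    have hlim := tendsto_measure_cthickening_of_isClosed
      (μ := (ν : Measure (Space d)).map (x + ·)) ⟨1, one_pos, measure_ne_top _ _⟩ hF
    rw [hpre hF.measurableSet, hν x] at hlim
    have hev : ∀ᶠ r in 𝓝[>] (0 : ℝ), (ν : Measure (Space d)).map (x + ·)
        (Metric.cthickening r F) < δ ∧ 0 < r :=
      ((hlim.mono_left nhdsWithin_le_nhds).eventually (gt_mem_nhds hδ)).and self_mem_nhdsWithin
    obtain ⟨r, hr, hr0⟩ := hev.exists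
    rw [hpre Metric.isClosed_cthickening.measurableSet] at hr
    have hclosed : IsClosed {y | x + y ∈ Metric.cthickening r F} :=
      Metric.isClosed_cthickening.preimage (continuous_const_add x)
    have hlt := eventually_lt_of_limsup_lt
      ((ProbabilityMeasure.limsup_measure_closed_le_of_tendsto hμ hclosed).trans_lt hr)
    -- Half of `r` pays for moving the starting point from `x` to `z`, half for the thickening.
    refine ⟨Metric.ball x (r / 2), mem_nhdsWithin_of_mem_nhds (Metric.ball_mem_nhds _ (by positivity)),
      r / 2, by positivity, ?_⟩
    filter_upwards [hlt] with n hn z hz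
    have hsub : {y | z + y ∈ Metric.thickening (r / 2) F} ⊆
        {y | x + y ∈ Metric.cthickening r F} := ?_
    · exact (measure_mono hsub).trans hn.le
    intro y hy
    have hy' : z + y ∈ Metric.thickening (r / 2) F := hy
    obtain ⟨w, hw, hd⟩ := Metric.mem_thickening_iff.1 hy'
    change x + y ∈ Metric.cthickening r F
    refine Metric.mem_cthickening_of_dist_le _ w _ _ hw ?_
    have h1 : dist (x + y) (z + y) < r / 2 := by
      rw [dist_add_right, dist_comm]; exact hz
    linarith [dist_triangle (x + y) (z + y) w]

/-- Write `a n ^ l n` as the exponential of `(l n / n) * (n * log (a n))`; the second factor tends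
to `z`. -/
theorem tendsto_pow_of_tendsto_mul_sub_one {a : ℕ → ℂ} {z : ℂ}
    (ha : Tendsto (fun n : ℕ => (n : ℂ) * (a n - 1)) atTop (𝓝 z)) {l : ℕ → ℕ} {τ : ℝ}
    (hl : Tendsto (fun n : ℕ => (l n : ℝ) / n) atTop (𝓝 τ)) :
    Tendsto (fun n => a n ^ l n) atTop (𝓝 (Complex.exp (τ * z))) := by
  have hlog := Complex.tendsto_nat_mul_log_one_add_of_tendsto ha
  have hl' : Tendsto (fun n : ℕ => (((l n : ℝ) / n : ℝ) : ℂ)) atTop (𝓝 (τ : ℂ)) :=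
    (Complex.continuous_ofReal.tendsto τ).comp hl
  have hexp := (Complex.continuous_exp.tendsto _).comp (hl'.mul hlog)
  have h0 : Tendsto (fun n => a n - 1) atTop (𝓝 0) := by
    have := (tendsto_inv_atTop_nhds_zero_nat (𝕜 := ℂ)).mul ha
    rw [zero_mul] at this
    refine this.congr' ?_
    filter_upwards [eventually_ne_atTop 0] with n hn
    have : (n : ℂ) ≠ 0 := by exact_mod_cast hn
    field_simp
  have hne : ∀ᶠ n in atTop, a n ≠ 0 := by
    have h1 : Tendsto a atTop (𝓝 1) := by simpa using h0.add_const 1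
    exact h1.eventually_ne one_ne_zero
  refine hexp.congr' ?_
  filter_upwards [hne, eventually_ne_atTop 0] with n hn hn0
  have : (n : ℂ) ≠ 0 := by exact_mod_cast hn0
  simp only [Function.comp_apply, add_sub_cancel]
  rw [← Complex.exp_log hn, ← Complex.exp_nat_mul, Complex.exp_log hn]
  congr 1
  push_cast
  field_simp

/-! ### Second-order expansion of the characteristic function of one step -/

section Step

variable {d : ℕ} {Ω : Type*} [MeasurableSpace Ω] {P : Measure Ω} [IsProbabilityMeasure P]
  {X : Ω → Space d} {σ : ℝ}

theorem integral_inner_eq_zero (hL2 : MemLp X 2 P) (hmean : ∫ ω, X ω ∂P = 0) (u : Space d) :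
    ∫ ω, inner ℝ u (X ω) ∂P = 0 := by
  rw [integral_inner (hL2.integrable (by norm_num)), hmean, inner_zero_right]

theorem integral_inner_sq (hL2 : MemLp X 2 P) (hmean : ∫ ω, X ω ∂P = 0)
    (hcov : ∀ i j : Fin d,
      covariance (fun ω => X ω i) (fun ω => X ω j) P = if i = j then σ ^ 2 else 0)
    (u : Space d) : ∫ ω, (inner ℝ u (X ω)) ^ 2 ∂P = σ ^ 2 * ‖u‖ ^ 2 := by
  have hi : ∀ i, MemLp (fun ω => u i * X ω i) 2 P := fun i =>
    ((EuclideanSpace.proj (𝕜 := ℝ) i).comp_memLp' hL2).const_mul (u i)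
  have hsum : (fun ω => inner ℝ u (X ω)) = fun ω => ∑ i, u i * X ω i := by
    funext ω
    simp [PiLp.inner_apply, mul_comm]
  have hm : AEMeasurable (fun ω => inner ℝ u (X ω)) P :=
    (hL2.1.const_inner (𝕜 := ℝ) (c := u)).aemeasurable
  rw [← variance_of_integral_eq_zero hm (integral_inner_eq_zero hL2 hmean u),
    ← covariance_self hm, hsum, covariance_fun_sum_fun_sum hi hi]
  simp_rw [covariance_const_mul_left, covariance_const_mul_right, hcov]
  simp [EuclideanSpace.norm_sq_eq, Finset.mul_sum]
  exact Finset.sum_congr rfl fun i _ => by ring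

/-- The projection of `X` on the direction `u`, divided by `σ`, is a centered real variable of
variance one, so the scalar Taylor expansion at order two applies. -/
theorem tendsto_mul_charFun_sub_one (hX : Measurable X) (hL2 : MemLp X 2 P)
    (hmean : ∫ ω, X ω ∂P = 0) (hσ : 0 < σ)
    (hcov : ∀ i j : Fin d,
      covariance (fun ω => X ω i) (fun ω => X ω j) P = if i = j then σ ^ 2 else 0)
    (u : Space d) :
    Tendsto (fun n : ℕ => (n : ℂ) * (charFun (P.map X) ((σ * √(n : ℝ))⁻¹ • u) - 1)) atTop
      (𝓝 (-(‖u‖ : ℂ) ^ 2 / 2)) := by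
  have : IsProbabilityMeasure (P.map X) := Measure.isProbabilityMeasure_map hX.aemeasurable
  rcases eq_or_ne u 0 with rfl | hu
  · simp
  have hu0 : 0 < ‖u‖ := norm_pos_iff.2 hu
  set Y : Ω → ℝ := fun ω => (σ * ‖u‖)⁻¹ * inner ℝ u (X ω) with hY
  have hYm : Measurable Y := by fun_prop
  have hY0 : ∫ ω, Y ω ∂P = 0 := by
    rw [hY, integral_const_mul, integral_inner_eq_zero hL2 hmean, mul_zero]
  have hY1 : ∫ ω, (Y ^ 2) ω ∂P = 1 := by
    simp only [hY, Pi.pow_apply, mul_pow]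
    rw [integral_const_mul, integral_inner_sq hL2 hmean hcov]
    field_simp
  have hchar : ∀ s : ℝ, charFun (P.map Y) (s * ‖u‖) = charFun (P.map X) ((σ⁻¹ * s) • u) := by
    intro s
    rw [charFun_apply, charFun_apply, integral_map hYm.aemeasurable
      (by fun_prop), integral_map hX.aemeasurable (by fun_prop)]
    congr 1
    funext ω
    congr 3
    simp only [hY, inner_smul_right, real_inner_comm u (X ω)]
    simp
    field_simp
  have hs : Tendsto (fun n : ℕ => (√(n : ℝ))⁻¹ * ‖u‖) atTop (𝓝 0) := by
    rw [← zero_mul ‖u‖]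
    exact .mul_const _ (tendsto_inv_atTop_zero.comp <| Real.tendsto_sqrt_atTop.comp <|
      tendsto_natCast_atTop_atTop)
  have hO : (fun n : ℕ => charFun (P.map X) ((σ * √(n : ℝ))⁻¹ • u) -
      (1 - (‖u‖ : ℂ) ^ 2 / 2 * (n : ℂ)⁻¹)) =o[atTop] fun n : ℕ => (n : ℂ)⁻¹ := by
    have h1 := (taylor_charFun_two hYm.aemeasurable hY0 hY1).comp_tendsto hs
    refine (h1.congr_left fun n => ?_).trans_isBigO
      (Asymptotics.IsBigO.of_bound (‖u‖ ^ 2) (Eventually.of_forall fun n => ?_))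
    · have h2 : (((√(n : ℝ))⁻¹ : ℝ) : ℂ) ^ 2 = (n : ℂ)⁻¹ := by
        rw [← Complex.ofReal_pow, inv_pow, Real.sq_sqrt n.cast_nonneg]
        simp
      simp only [Function.comp_apply, hchar]
      rw [mul_inv, Complex.ofReal_mul, mul_pow, h2]
      ring
    · simp [mul_pow, mul_comm]
  have hT : Tendsto (fun n : ℕ => (n : ℂ) * (charFun (P.map X) ((σ * √(n : ℝ))⁻¹ • u) - 1)
      - (-(‖u‖ : ℂ) ^ 2 / 2)) atTop (𝓝 0) := by
    refine hO.tendsto_div_nhds_zero.congr' ?_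
    filter_upwards [eventually_ne_atTop 0] with n hn
    have : (n : ℂ) ≠ 0 := by exact_mod_cast hn
    field_simp
    ring
  have hT' := hT.add_const (-(‖u‖ : ℂ) ^ 2 / 2)
  rw [zero_add] at hT'
  exact hT'.congr fun n => sub_add_cancel _ _

end Step
-- Survival events, interpolated paths and the limit law of increments
section Walk

variable {Ω : Type*} {d : ℕ}

theorem mem_survival_iff (ξ : ℕ → Ω → Space d) (C : Set (Space d)) (n : ℕ) (ω : Ω) :
    ω ∈ survival ξ C n ↔ ∀ k, 1 ≤ k → k ≤ n → walk ξ k ω ∈ C := by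
  constructor
  · intro h k hk hkn
    by_contra hC
    have h1 : exitTime ξ C ω ≤ (k : ℕ∞) := sInf_le ⟨k, hk, hC, rfl⟩
    have h2 : (n : ℕ∞) < k := lt_of_lt_of_le h h1
    exact absurd (by exact_mod_cast h2) (not_lt.2 hkn)
  · intro h
    have h1 : ((n + 1 : ℕ) : ℕ∞) ≤ exitTime ξ C ω := by
      refine le_sInf ?_
      rintro _ ⟨k, hk, hC, rfl⟩
      by_contra hlt
      have hkn : k < n + 1 := by exact_mod_cast not_le.1 hlt
      exact hC (h k hk (by omega))
    exact lt_of_lt_of_le (by exact_mod_cast n.lt_succ_self) h1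

theorem survival_antitone (ξ : ℕ → Ω → Space d) (C : Set (Space d)) :
    Antitone (survival ξ C) := fun m n hmn ω hω =>
  (mem_survival_iff ξ C m ω).2 fun k hk hkm =>
    (mem_survival_iff ξ C n ω).1 hω k hk (hkm.trans hmn)

theorem interp_natCast (ξ : ℕ → Ω → Space d) (ω : Ω) (m : ℕ) :
    interp ξ ω m = walk ξ m ω := by
  simp [interp]

/-- The weights of the steps of the walk in its interpolated position at time `x`. -/
noncomputable def stepWeight (x : ℝ) (i : ℕ) : ℝ := if i < ⌊x⌋₊ then 1 else x - ⌊x⌋₊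

theorem interp_sub_walk (ξ : ℕ → Ω → Space d) (ω : Ω) {x : ℝ} {m : ℕ} (hm : m ≤ ⌊x⌋₊) :
    interp ξ ω x - walk ξ m ω = ∑ i ∈ Finset.Ico m (⌊x⌋₊ + 1), stepWeight x i • ξ i ω := by
  have h1 : ∑ i ∈ Finset.Ico m ⌊x⌋₊, stepWeight x i • ξ i ω =
      ∑ i ∈ Finset.Ico m ⌊x⌋₊, ξ i ω := by
    refine Finset.sum_congr rfl fun i hi => ?_
    rw [stepWeight, if_pos (Finset.mem_Ico.1 hi).2, one_smul]
  rw [Finset.sum_Ico_succ_top hm, h1, Finset.sum_Ico_eq_sub _ hm, stepWeight,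
    if_neg (lt_irrefl _), interp, walk, walk]
  abel

theorem norm_smul_walk_le_norm_path (ξ : ℕ → Ω → Space d) (σ : ℝ) (ω : Ω) {m n : ℕ}
    (hn : 0 < n) (hmn : m ≤ n) :
    ‖(σ * √(n : ℝ))⁻¹ • walk ξ m ω‖ ≤ ‖path ξ σ n ω‖ := by
  have hn' : (0 : ℝ) < n := by exact_mod_cast hn
  have hmem : (m : ℝ) / n ∈ unitInterval :=
    ⟨by positivity, (div_le_one hn').2 (by exact_mod_cast hmn)⟩
  have h := ContinuousMap.norm_coe_le_norm (path ξ σ n ω) ⟨(m : ℝ) / n, hmem⟩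
  have h1 : path ξ σ n ω ⟨(m : ℝ) / n, hmem⟩ = (σ * √(n : ℝ))⁻¹ • walk ξ m ω := by
    change (σ * √(n : ℝ))⁻¹ • interp ξ ω ((n : ℝ) * ((m : ℝ) / n)) = _
    rw [mul_div_cancel₀ _ hn'.ne', interp_natCast]
  rwa [h1] at h

/-- The normalized displacement of the walk between the last integer time before `n s` and the
time `n t`. -/
noncomputable def increment (ξ : ℕ → Ω → Space d) (σ s t : ℝ) (n : ℕ) (ω : Ω) : Space d :=
  (σ * √(n : ℝ))⁻¹ • (interp ξ ω (n * t) - walk ξ ⌊n * s⌋₊ ω)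

theorem floor_mul_le_floor_mul {s t : ℝ} (hst : s ≤ t) (n : ℕ) :
    ⌊(n : ℝ) * s⌋₊ ≤ ⌊(n : ℝ) * t⌋₊ :=
  Nat.floor_le_floor (mul_le_mul_of_nonneg_left hst n.cast_nonneg)

theorem increment_eq_sum (ξ : ℕ → Ω → Space d) {s t : ℝ} (hst : s ≤ t) (σ : ℝ) (n : ℕ) :
    increment ξ σ s t n = fun ω => ∑ i ∈ Finset.Ico ⌊n * s⌋₊ (⌊n * t⌋₊ + 1),
      ((σ * √(n : ℝ))⁻¹ * stepWeight (n * t) i) • ξ i ω := by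
  funext ω
  rw [increment, interp_sub_walk ξ ω (floor_mul_le_floor_mul hst n), Finset.smul_sum]
  simp_rw [smul_smul]

variable [MeasurableSpace Ω] {ξ : ℕ → Ω → Space d}

theorem measurable_walk (hξ : ∀ i, Measurable (ξ i)) (n : ℕ) : Measurable (walk ξ n) :=
  Finset.measurable_fun_sum _ fun i _ => hξ i

theorem measurableSet_survival (hξ : ∀ i, Measurable (ξ i)) {C : Set (Space d)}
    (hC : MeasurableSet C) (n : ℕ) : MeasurableSet (survival ξ C n) := by
  have h : survival ξ C n = ⋂ k ∈ Finset.Icc 1 n, walk ξ k ⁻¹' C := by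
    ext ω
    simp [mem_survival_iff]
  rw [h]
  exact Finset.measurableSet_biInter _ fun k _ => measurable_walk hξ k hC

/-- The path is a continuous function, obtained by currying, of the first `n` steps. -/
theorem measurable_path (hξ : ∀ i, Measurable (ξ i)) (σ : ℝ) (n : ℕ) :
    Measurable (path ξ σ n) := by
  let F : (Finset.range n → Space d) × unitInterval → Space d := fun p =>
    (σ * √(n : ℝ))⁻¹ • ∑ i : Finset.range n, max 0 (min 1 ((n : ℝ) * p.2 - (i : ℝ))) • p.1 i
  have hF : Continuous F := by fun_prop
  have hg : Continuous (ContinuousMap.curry ⟨F, hF⟩) := (ContinuousMap.curry ⟨F, hF⟩).continuous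
  have hz : Measurable fun ω => fun i : Finset.range n => ξ i ω :=
    measurable_pi_lambda _ fun i => hξ i
  convert hg.measurable.comp hz using 1
  funext ω
  ext1 t
  change (σ * √(n : ℝ))⁻¹ • interp ξ ω ((n : ℝ) * t) = (σ * √(n : ℝ))⁻¹ • _
  rw [interp_eq_sum ξ ω n _ (mul_nonneg n.cast_nonneg t.2.1)
    (mul_le_of_le_one_right n.cast_nonneg t.2.2), ← Finset.sum_coe_sort]

theorem measurable_increment (hξ : ∀ i, Measurable (ξ i)) {s t : ℝ} (hst : s ≤ t) (σ : ℝ)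
    (n : ℕ) : Measurable (increment ξ σ s t n) := by
  rw [increment_eq_sum ξ hst]
  exact Finset.measurable_fun_sum _ fun i _ => (hξ i).fun_const_smul _

variable {P : Measure Ω}

theorem indepFun_restrict_increment (hξ : ∀ i, Measurable (ξ i)) (hindep : iIndepFun ξ P)
    {s t : ℝ} (hst : s ≤ t) (σ : ℝ) (n : ℕ) :
    IndepFun (fun ω => fun i : Finset.range ⌊n * s⌋₊ => ξ i ω) (increment ξ σ s t n) P := by
  have h := hindep.indepFun_finset (Finset.range ⌊n * s⌋₊)
    (Finset.Ico ⌊n * s⌋₊ (⌊n * t⌋₊ + 1)) (by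
      rw [Finset.disjoint_left]
      intro i hi hi'
      have h1 := Finset.mem_range.1 hi
      have h2 := (Finset.mem_Ico.1 hi').1
      omega) hξ
  let ψ : (Finset.Ico ⌊n * s⌋₊ (⌊n * t⌋₊ + 1) → Space d) → Space d := fun z =>
    ∑ i : Finset.Ico ⌊n * s⌋₊ (⌊n * t⌋₊ + 1), ((σ * √(n : ℝ))⁻¹ * stepWeight (n * t) i) • z i
  have hψ : Measurable ψ :=
    Finset.measurable_fun_sum _ fun i _ => (measurable_pi_apply i).fun_const_smul _
  have h' := h.comp measurable_id hψ
  have hψξ : (ψ ∘ fun ω => fun i : Finset.Ico ⌊n * s⌋₊ (⌊n * t⌋₊ + 1) => ξ i ω) =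
      increment ξ σ s t n := by
    rw [increment_eq_sum ξ hst]
    funext ω
    rw [← Finset.sum_coe_sort]
    rfl
  rwa [hψξ] at h'

/-- The whole steps give the power; the last, fractional step gives the other factor, which tends to
`1` because its argument tends to `0`. -/
theorem charFun_map_increment (hξ : ∀ i, Measurable (ξ i)) (hindep : iIndepFun ξ P)
    (hident : ∀ i, IdentDistrib (ξ i) (ξ 0) P P) {s t : ℝ} (hst : s ≤ t) (σ : ℝ) (n : ℕ)
    (u : Space d) :
    charFun (P.map (increment ξ σ s t n)) u =
      charFun (P.map (ξ 0)) ((σ * √(n : ℝ))⁻¹ • u) ^ (⌊n * t⌋₊ - ⌊n * s⌋₊) *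
      charFun (P.map (ξ 0)) ((n * t - ⌊n * t⌋₊ : ℝ) • (σ * √(n : ℝ))⁻¹ • u) := by
  have hm : ∀ i ∈ Finset.Ico ⌊n * s⌋₊ (⌊n * t⌋₊ + 1), AEMeasurable
      (fun ω => ((σ * √(n : ℝ))⁻¹ * stepWeight (n * t) i) • ξ i ω) P :=
    fun i _ => ((hξ i).fun_const_smul _).aemeasurable
  have hi : iIndepFun (fun i ω => ((σ * √(n : ℝ))⁻¹ * stepWeight (n * t) i) • ξ i ω) P :=
    hindep.comp (fun i x => ((σ * √(n : ℝ))⁻¹ * stepWeight (n * t) i) • x)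
      fun i => measurable_id.fun_const_smul _
  have hterm : ∀ i, charFun
      (P.map fun ω => ((σ * √(n : ℝ))⁻¹ * stepWeight (n * t) i) • ξ i ω) u =
      charFun (P.map (ξ 0)) (stepWeight (n * t) i • (σ * √(n : ℝ))⁻¹ • u) := fun i => by
    rw [charFun_map_smul_comp (hξ i).aemeasurable, (hident i).map_eq, smul_smul, mul_comm]
  rw [increment_eq_sum ξ hst, iIndepFun.charFun_map_fun_finsetSum_eq_prod hm (hi.restrict _),
    Finset.prod_apply, Finset.prod_Ico_succ_top (floor_mul_le_floor_mul hst n), hterm,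
    stepWeight, if_neg (lt_irrefl _)]
  congr 1
  rw [← Nat.card_Ico, ← Finset.prod_const]
  refine Finset.prod_congr rfl fun i hi => ?_
  rw [hterm, stepWeight, if_pos (Finset.mem_Ico.1 hi).2, one_smul]

variable [IsProbabilityMeasure P]

theorem tendsto_charFun_increment (hξ : ∀ i, Measurable (ξ i)) (hindep : iIndepFun ξ P)
    (hident : ∀ i, IdentDistrib (ξ i) (ξ 0) P P) (hL2 : MemLp (ξ 0) 2 P)
    (hmean : ∫ ω, ξ 0 ω ∂P = 0) {σ : ℝ} (hσ : 0 < σ)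
    (hcov : ∀ i j : Fin d,
      covariance (fun ω => ξ 0 ω i) (fun ω => ξ 0 ω j) P = if i = j then σ ^ 2 else 0)
    {s t : ℝ} (hs : 0 ≤ s) (hst : s ≤ t) (u : Space d) :
    Tendsto (fun n => charFun (P.map (increment ξ σ s t n)) u) atTop
      (𝓝 (Complex.exp ((t - s : ℝ) * (-(‖u‖ : ℂ) ^ 2 / 2)))) := by
  have : IsProbabilityMeasure (P.map (ξ 0)) := Measure.isProbabilityMeasure_map (hξ 0).aemeasurable
  have hfloor : ∀ {r : ℝ}, 0 ≤ r → Tendsto (fun n : ℕ => (⌊(n : ℝ) * r⌋₊ : ℝ) / n) atTop (𝓝 r) := by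
    intro r hr
    simpa [Function.comp_def, mul_comm] using
      (tendsto_nat_floor_mul_div_atTop hr).comp tendsto_natCast_atTop_atTop
  have hl : Tendsto (fun n : ℕ => ((⌊(n : ℝ) * t⌋₊ - ⌊(n : ℝ) * s⌋₊ : ℕ) : ℝ) / n) atTop
      (𝓝 (t - s)) := by
    refine ((hfloor (hs.trans hst)).sub (hfloor hs)).congr fun n => ?_
    rw [Nat.cast_sub (floor_mul_le_floor_mul hst n), sub_div]
  have h1 := tendsto_pow_of_tendsto_mul_sub_one
    (tendsto_mul_charFun_sub_one (hξ 0) hL2 hmean hσ hcov u) hl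
  have hc : Tendsto (fun n : ℕ => (σ * √(n : ℝ))⁻¹ • u) atTop (𝓝 0) := by
    rw [← zero_smul ℝ u]
    exact .smul_const (tendsto_inv_atTop_zero.comp <| (Real.tendsto_sqrt_atTop.comp <|
      tendsto_natCast_atTop_atTop).const_mul_atTop hσ) u
  have hf : Tendsto (fun n : ℕ => ((n : ℝ) * t - ⌊(n : ℝ) * t⌋₊) • (σ * √(n : ℝ))⁻¹ • u) atTop (𝓝 0) := by
    refine squeeze_zero_norm (fun n => ?_) (tendsto_zero_iff_norm_tendsto_zero.1 hc)
    have h0 := Nat.floor_le (mul_nonneg n.cast_nonneg (hs.trans hst) : 0 ≤ (n : ℝ) * t)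
    have h1 := Nat.lt_floor_add_one ((n : ℝ) * t)
    rw [norm_smul, Real.norm_of_nonneg (sub_nonneg.2 h0)]
    exact mul_le_of_le_one_left (norm_nonneg _) (by linarith)
  have h2 := ((continuous_charFun (μ := P.map (ξ 0))).tendsto 0).comp hf
  have h3 := h1.mul h2
  simp only [charFun_zero, probReal_univ, Complex.ofReal_one, mul_one] at h3
  refine h3.congr fun n => ?_
  rw [charFun_map_increment hξ hindep hident hst, Function.comp_apply]

end Walk
-- The Markov property and the conditional laws
section Walk

variable {Ω : Type*} {d : ℕ} [MeasurableSpace Ω] {ξ : ℕ → Ω → Space d}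
  {P : Measure Ω}

theorem condLaw_apply (hξ : ∀ i, Measurable (ξ i)) (σ : ℝ) {C : Set (Space d)}
    (hC : MeasurableSet C) (n : ℕ) {B : Set (PathSpace d)} (hB : MeasurableSet B) :
    (condLaw P ξ σ C n : Measure (PathSpace d)) B =
      (P (survival ξ C n))⁻¹ * P (survival ξ C n ∩ path ξ σ n ⁻¹' B) := by
  change (P[|survival ξ C n]).map (path ξ σ n) B = _
  rw [Measure.map_apply (measurable_path hξ σ n) hB,
    cond_apply (measurableSet_survival hξ hC n)]

variable [IsProbabilityMeasure P]

/-- The increments of the normalized walk converge in law to a Gaussian, which does not charge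
the translates of the frontier of a convex set: they are uniformly unlikely to lead from a compact
set to a neighbourhood of this frontier. -/
theorem exists_thickening_increment_uniformly_small (hξ : ∀ i, Measurable (ξ i))
    (hindep : iIndepFun ξ P) (hident : ∀ i, IdentDistrib (ξ i) (ξ 0) P P)
    (hL2 : MemLp (ξ 0) 2 P) (hmean : ∫ ω, ξ 0 ω ∂P = 0) {σ : ℝ} (hσ : 0 < σ)
    (hcov : ∀ i j : Fin d,
      covariance (fun ω => ξ 0 ω i) (fun ω => ξ 0 ω j) P = if i = j then σ ^ 2 else 0)
    {C : Set (Space d)} (hC : Convex ℝ C) {s t : ℝ} (hs : 0 ≤ s) (hst : s < t)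
    {K : Set (Space d)} (hK : IsCompact K) {δ : ℝ≥0∞} (hδ : 0 < δ) :
    ∃ ε > 0, ∀ᶠ n in atTop, ∀ x ∈ K, P.map (increment ξ σ s t n)
      {y | x + y ∈ Metric.thickening ε (frontier C)} ≤ δ := by
  obtain ⟨ν, hac, hν⟩ := exists_gaussian_absolutelyContinuous d (sub_pos.2 hst)
  let μ : ℕ → ProbabilityMeasure (Space d) := fun n => ⟨P.map (increment ξ σ s t n),
    Measure.isProbabilityMeasure_map (measurable_increment hξ hst.le σ n).aemeasurable⟩
  have hμ : Tendsto μ atTop (𝓝 ν) := by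
    rw [ProbabilityMeasure.tendsto_iff_tendsto_charFun]
    intro u
    rw [hν u]
    exact tendsto_charFun_increment hξ hindep hident hL2 hmean hσ hcov hs hst.le u
  refine exists_thickening_uniformly_small hμ isClosed_frontier (fun x => hac ?_) hK hδ
  exact (measure_preimage_add volume x (frontier C)).trans (hC.addHaar_frontier volume)

/-- The Markov property at time `[ns]`: the walk survives until this time, and from a bounded
position its next increment has to lead into `G`. -/
theorem measure_survival_inter_path_le (hξ : ∀ i, Measurable (ξ i)) (hindep : iIndepFun ξ P)
    {σ : ℝ} {C : Set (Space d)} (hC : MeasurableSet C) {s : ℝ} {t : unitInterval}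
    (hst : s ≤ t) {n : ℕ} (hn : 0 < n) {G : Set (Space d)} (hG : MeasurableSet G) {R : ℝ}
    {δ : ℝ≥0∞} (h : ∀ x ∈ Metric.closedBall (0 : Space d) R,
      P.map (increment ξ σ s t n) {y | x + y ∈ G} ≤ δ) :
    P (survival ξ C n ∩ path ξ σ n ⁻¹' ({w | w t ∈ G} \ {w | R ≤ ‖w‖})) ≤
      δ * P (survival ξ C ⌊n * s⌋₊) := by
  set m := ⌊n * s⌋₊ with hm
  have hmn : m ≤ n := by
    refine (floor_mul_le_floor_mul (hst.trans t.2.2) n).trans ?_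
    simp
  set U : Ω → (Finset.range m → Space d) := fun ω i => ξ i ω with hU
  -- Extending the first `m` steps by zero makes survival up to `m` and the position at `m`
  -- functions of `U` alone.
  let η : ℕ → (Finset.range m → Space d) → Space d := fun i z =>
    if h : i ∈ Finset.range m then z ⟨i, h⟩ else 0
  have hη : ∀ i, Measurable (η i) := by
    intro i
    by_cases hi : i ∈ Finset.range m
    · simpa only [η, hi, dite_true] using measurable_pi_apply _
    · simpa only [η, hi, dite_false] using measurable_const
  have hηU : ∀ k ≤ m, ∀ ω, walk η k (U ω) = walk ξ k ω := by
    intro k hk ω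
    refine Finset.sum_congr rfl fun i hi => ?_
    have hi' : i ∈ Finset.range m :=
      Finset.mem_range.2 ((Finset.mem_range.1 hi).trans_le hk)
    simp only [η, hi', hU, dite_true]
  have hsurv : ∀ ω, U ω ∈ survival η C m ↔ ω ∈ survival ξ C m := by
    intro ω
    simp only [mem_survival_iff]
    exact forall_congr' fun k => forall_congr' fun _ => forall_congr' fun hk => by
      rw [hηU k hk]
  set f : (Finset.range m → Space d) → Space d := fun z => (σ * √(n : ℝ))⁻¹ • walk η m z with hf
  have hfm : Measurable f := (measurable_walk hη m).fun_const_smul _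
  have hUm : Measurable U := measurable_pi_lambda _ fun i => hξ i
  have hA : MeasurableSet (survival η C m ∩ f ⁻¹' Metric.closedBall 0 R) :=
    (measurableSet_survival hη hC m).inter (hfm Metric.isClosed_closedBall.measurableSet)
  refine le_trans (measure_mono ?_) ((measure_mem_inter_add_mem_le hUm
    (measurable_increment hξ hst σ n) (indepFun_restrict_increment hξ hindep hst σ n) hfm hA hG
    fun a ha => h _ ha.2).trans ?_)
  · rintro ω ⟨hω, hG', hR⟩
    have hfU : f (U ω) = (σ * √(n : ℝ))⁻¹ • walk ξ m ω := by rw [hf, ← hηU m le_rfl ω]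
    refine ⟨⟨(hsurv ω).2 (survival_antitone ξ C hmn hω), ?_⟩, ?_⟩
    · rw [Set.mem_preimage, mem_closedBall_zero_iff, hfU]
      exact (norm_smul_walk_le_norm_path ξ σ ω hn hmn).trans (not_le.1 hR).le
    · have hsum : f (U ω) + increment ξ σ s t n ω = path ξ σ n ω t := by
        rw [hfU, increment, ← smul_add, add_sub_cancel]
        rfl
      rw [hsum]
      exact hG'
  · gcongr
    exact fun ω hω => (hsurv ω).1 hω.1

theorem condLaw_le (hξ : ∀ i, Measurable (ξ i)) (hindep : iIndepFun ξ P)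
    {σ : ℝ} {C : Set (Space d)} (hC : MeasurableSet C) {s : ℝ} {t : unitInterval}
    (hst : s ≤ t) {n : ℕ} (hn : 0 < n) {G : Set (Space d)} (hG : IsOpen G) {R : ℝ}
    {δ : ℝ≥0∞} (h : ∀ x ∈ Metric.closedBall (0 : Space d) R,
      P.map (increment ξ σ s t n) {y | x + y ∈ G} ≤ δ) {K : ℝ} (hK0 : 0 ≤ K)
    (hK : P.real (survival ξ C ⌊n * s⌋₊) / P.real (survival ξ C n) ≤ K) :
    (condLaw P ξ σ C n : Measure (PathSpace d)) {w | w t ∈ G} ≤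
      (condLaw P ξ σ C n : Measure (PathSpace d)) {w | R ≤ ‖w‖} + δ * ENNReal.ofReal K := by
  have hGm : MeasurableSet {w : PathSpace d | w t ∈ G} :=
    (hG.preimage (continuous_eval_const t)).measurableSet
  have hRm : MeasurableSet {w : PathSpace d | R ≤ ‖w‖} :=
    (isClosed_le continuous_const continuous_norm).measurableSet
  refine (measure_le_inter_add_sdiff _ _ {w : PathSpace d | R ≤ ‖w‖}).trans ?_
  gcongr
  · exact Set.inter_subset_right
  rw [condLaw_apply hξ σ hC n (hGm.diff hRm)]
  -- If survival is null, the right side of `condLaw_apply` is `⊤ * 0 = 0`.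
  by_cases h0 : P (survival ξ C n) = 0
  · simp [measure_inter_null_of_null_left, h0]
  have hpos : 0 < P.real (survival ξ C n) := ENNReal.toReal_pos h0 (measure_ne_top _ _)
  rw [div_le_iff₀ hpos] at hK
  have hK' : P (survival ξ C ⌊n * s⌋₊) ≤ ENNReal.ofReal K * P (survival ξ C n) := by
    rw [← ofReal_measureReal, ← ofReal_measureReal, ← ENNReal.ofReal_mul hK0]
    exact ENNReal.ofReal_le_ofReal hK
  calc (P (survival ξ C n))⁻¹ *
        P (survival ξ C n ∩ path ξ σ n ⁻¹' ({w | w t ∈ G} \ {w | R ≤ ‖w‖}))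
      ≤ (P (survival ξ C n))⁻¹ * (δ * (ENNReal.ofReal K * P (survival ξ C n))) := by
        gcongr
        exact (measure_survival_inter_path_le hξ hindep hC hst hn hG.measurableSet h).trans
          (by gcongr)
    _ = δ * ENNReal.ofReal K := by
        rw [← mul_assoc δ, mul_comm _ (P (survival ξ C n)), ← mul_assoc,
          ENNReal.inv_mul_cancel h0 (measure_ne_top _ _), one_mul]

end Walk

/-! ### Bounds from dominated variation and weak convergence -/

theorem DominatedlyVarying.exists_eventually_le {u : ℕ → ℝ} (hu : DominatedlyVarying u) {s : ℝ}
    (hs : 0 < s) (hs1 : s ≤ 1) :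
    ∃ K : ℝ, 0 < K ∧ ∀ᶠ n : ℕ in atTop, u ⌊(n : ℝ) * s⌋₊ / u n ≤ K := by
  obtain ⟨K, hK, -⟩ := EReal.lt_iff_exists_real_btwn.1 (hu s hs hs1)
  refine ⟨max K 1, by positivity, (eventually_lt_of_limsup_lt hK).mono fun n hn => ?_⟩
  exact (EReal.coe_lt_coe_iff.1 hn).le.trans (le_max_left _ _)

/-- Weak convergence bounds the mass of paths that meet a closed set at time `t` by the masses of
those that come close to it. -/
theorem measure_le_of_eventually_thickening_le {d : ℕ} {Qs : ℕ → FiniteMeasure (PathSpace d)}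
    {Q : FiniteMeasure (PathSpace d)} (hQ : Tendsto Qs atTop (𝓝 Q)) (t : unitInterval)
    (F : Set (Space d)) {ε : ℝ} (hε : 0 < ε) {c : ℝ≥0∞}
    (h : ∀ᶠ k in atTop,
      (Qs k : Measure (PathSpace d)) {w | w t ∈ Metric.thickening ε F} ≤ c) :
    (Q : Measure (PathSpace d)) {w | w t ∈ F} ≤ c := by
  have hopen : IsOpen {w : PathSpace d | w t ∈ Metric.thickening ε F} :=
    Metric.isOpen_thickening.preimage (continuous_eval_const t)
  -- A continuous function of `w t`, equal to `1` on `F` and `0` off the thickening, separates the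
  -- two events.
  let f : BoundedContinuousFunction (PathSpace d) NNReal :=
    (thickenedIndicator hε F).compContinuous ⟨fun w => w t, continuous_eval_const t⟩
  have hlim := FiniteMeasure.tendsto_iff_forall_lintegral_tendsto.1 hQ f
  have hle : ∫⁻ w, (f w : ℝ≥0∞) ∂(Q : Measure (PathSpace d)) ≤ c := by
    refine le_of_tendsto hlim (h.mono fun k hk => le_trans ?_ hk)
    rw [← lintegral_indicator_one hopen.measurableSet]
    refine lintegral_mono fun w => ?_
    by_cases hw : w t ∈ Metric.thickening ε F
    · rw [Set.indicator_of_mem (by exact hw)]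
      have h1 : f w ≤ 1 := thickenedIndicator_le_one hε F (w t)
      exact ENNReal.coe_le_one_iff.2 h1
    · have h0 : f w = 0 := thickenedIndicator_zero hε F hw
      simp [h0]
  refine le_trans ?_ hle
  have hsub : {w : PathSpace d | w t ∈ F} ⊆ {w | 1 ≤ (f w : ℝ≥0∞)} := fun w hw => by
    have h1 : f w = 1 := thickenedIndicator_one hε F hw
    simp [h1]
  refine (measure_mono hsub).trans ?_
  have hfm : Measurable fun w => (f w : ℝ≥0∞) := f.continuous.measurable.coe_nnreal_ennreal
  simpa using mul_meas_ge_le_lintegral hfm 1 (μ := (Q : Measure (PathSpace d)))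

theorem exists_measure_norm_ge_lt {E : Type*} [NormedAddCommGroup E] [MeasurableSpace E]
    [BorelSpace E] (Q : Measure E) [IsFiniteMeasure Q] {η : ℝ≥0∞} (hη : 0 < η) :
    ∃ R : ℝ, Q {w | R ≤ ‖w‖} < η := by
  have hanti : Antitone fun N : ℕ => {w : E | (N : ℝ) ≤ ‖w‖} := fun m n hmn w hw =>
    (Nat.cast_le.2 hmn : (m : ℝ) ≤ n).trans hw
  have hlim := tendsto_measure_iInter_atTop (μ := Q)
    (fun N => (isClosed_le continuous_const continuous_norm).measurableSet.nullMeasurableSet)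
    hanti ⟨0, measure_ne_top _ _⟩
  have hempty : ⋂ N : ℕ, {w : E | (N : ℝ) ≤ ‖w‖} = ∅ := by
    refine Set.eq_empty_of_forall_notMem fun w hw => ?_
    obtain ⟨N, hN⟩ := exists_nat_gt ‖w‖
    exact absurd (Set.mem_iInter.1 hw N) (not_le.2 hN)
  rw [hempty, measure_empty] at hlim
  obtain ⟨N, hN⟩ := (hlim.eventually (gt_mem_nhds hη)).exists
  exact ⟨N, hN⟩

end ConeWalk

/-! ### Conclusion -/

theorem mainTheorem4 {d : ℕ} (hd : 1 ≤ d) {Ω : Type*} [MeasurableSpace Ω]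
    (P : Measure Ω) [IsProbabilityMeasure P]
    (ξ : ℕ → Ω → ConeWalk.Space d)
    (hmeas : ∀ i, Measurable (ξ i))
    (hindep : iIndepFun ξ P)
    (hident : ∀ i, IdentDistrib (ξ i) (ξ 0) P P)
    (hL2 : MemLp (ξ 0) 2 P)
    (hmean : ∫ ω, ξ 0 ω ∂P = 0)
    (σ : ℝ) (hσ : 0 < σ)
    (hcov : ∀ i j : Fin d,
      covariance (fun ω => ξ 0 ω i) (fun ω => ξ 0 ω j) P = if i = j then σ ^ 2 else 0)
    (C : Set (ConeWalk.Space d)) (hCmeas : MeasurableSet C)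
    (hC : ConeWalk.IsAdaptedCone P (ξ 0) C)
    (Q : ProbabilityMeasure (ConeWalk.PathSpace d))
    (hQ : ConeWalk.IsWeakLimitPoint (ConeWalk.condLaw P ξ σ C) Q)
    (hdom : ConeWalk.DominatedlyVarying (fun n : ℕ => P.real (ConeWalk.survival ξ C n))) :
    ConeWalk.BoundaryUnreachable C Q := by
  intro t ht
  obtain ⟨φ, hφ, hlim⟩ := hQ
  have ht0 : (0 : ℝ) < t := ht
  -- Dominated variation needs `s > 0`; a nondegenerate Gaussian needs `s < t`.
  have hs0 : (0 : ℝ) < (t : ℝ) / 2 := half_pos ht0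
  have hst : (t : ℝ) / 2 < t := half_lt_self ht0
  obtain ⟨K, hK0, hK⟩ := hdom.exists_eventually_le hs0 (hst.le.trans t.2.2)
  have hK' : ENNReal.ofReal K ≠ 0 := (ENNReal.ofReal_pos.2 hK0).ne'
  suffices h : ∀ η : ENNReal, 0 < η →
      (Q : Measure (ConeWalk.PathSpace d)) {w | w t ∈ frontier C} ≤ η + η by
    refine nonpos_iff_eq_zero.1 (ENNReal.le_of_forall_pos_le_add fun ε hε _ => ?_)
    have hε' : (ε : ENNReal) ≠ 0 := by exact_mod_cast hε.ne'
    simpa [ENNReal.add_halves] using h (ε / 2) (ENNReal.half_pos hε')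
  intro η hη
  obtain ⟨R, hR⟩ := ConeWalk.exists_measure_norm_ge_lt (Q : Measure (ConeWalk.PathSpace d)) hη
  -- With `δ = η / K`, the loss `K` from conditioning leaves exactly `η`; the other `η` covers paths
  -- of norm at least `R`.
  obtain ⟨ε, hε, hsmall⟩ := ConeWalk.exists_thickening_increment_uniformly_small hmeas hindep
    hident hL2 hmean hσ hcov hC.convex hs0.le hst (isCompact_closedBall (0 : ConeWalk.Space d) R)
    (ENNReal.div_pos hη.ne' (ENNReal.ofReal_ne_top (r := K)))
  have hRev := eventually_lt_of_limsup_lt ((FiniteMeasure.limsup_measure_closed_le_of_tendsto hlim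
    (isClosed_le (continuous_const (y := R)) continuous_norm)).trans_lt hR)
  refine ConeWalk.measure_le_of_eventually_thickening_le hlim t (frontier C) hε ?_
  filter_upwards [hRev, hφ.tendsto_atTop.eventually hsmall, hφ.tendsto_atTop.eventually hK,
    hφ.tendsto_atTop.eventually (eventually_gt_atTop 0)] with k hk1 hk2 hk3 hk4
  refine (ConeWalk.condLaw_le hmeas hindep hCmeas hst.le hk4 Metric.isOpen_thickening hk2 hK0.le
    hk3).trans ?_
  rw [ENNReal.div_mul_cancel hK' ENNReal.ofReal_ne_top]
  gcongr
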